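/- A quantum graph $G$ is a pair of a finite-dimensional complex inner product space $V(G)$ and a real vector space $E(G)$ of self-adjoint operators on $V(G)$ that contains the identity $I$. Write $|G|=\dim_{\mathbb C}V(G)$ (the order) and $\|G\|=\dim_{\mathbb R}E(G)-1$ (the valence). A code of $G$ is a subspace $C\subseteq V(G)$ such that, for some function $\epsilon\colon E(G)\to\mathbb R$, one has $P_CAP_C=\epsilon(A)P_C$ for all $A\in E(G)$, where $P_C$ is the orthogonal projection onto $C$. A coloring of $G$ is a finite set $K$ of codes with $\sum_{C\in K}P_C=I$. Let $\alpha(G)$ be the largest dimension of a code of $G$, let $\chi(G)$ be the smallest cardinality of a coloring of $G$, and let $\chi(n,m)$ be the maximum of $\chi(G)$ over all quantum graphs $G$ with $|G|=n$ and $\|G\|=m$. For integers $n,m\ge 0$, denote by $Q_{n,m}$ any quantum graph of order $n$ and valence $m$ whose edge space is commutative and has a basis $I,A_1,\dots,A_m$ such that each $A_i$ has an orthonormal basis of eigenvectors $w_{i,1},\dots,w_{i,n}$ with eigenvalues $\lambda_{i,1},\dots,\lambda_{i,n}$ satisfying - (tropical) $0<\lambda_{i,j+1}<\lambda_{i,j}/n^2$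 for $1\le i\le m$ and $1\le j<n$; - (cyclical) $w_{i+1,j}=w_{i,\,j+\lfloor n/m\rfloor+\delta_i}$ for $1\le i<m$ and $1\le j\le n$, where $\delta_i=1$ if $i\le n\bmod m$ and $\delta_i=0$ otherwise, and the second index is read modulo $n$. Define the step logarithm by $\operatorname{slog}(0,q)=0$ and $\operatorname{slog}(p,q)=\operatorname{slog}(p-\lceil p/q\rceil,q)+1$ for positive integers $p,q$. Then: 1. For all integers $0\le m<n$ a graph $Q_{n,m}$ exists, and every graph $Q_{n,m}$ satisfies $\alpha(Q_{n,m})=\lceil n/(m+1)\rceil$. 2. For every integer $n\ge 2$, $\chi(n,1)=\operatorname{slog}(n,2)=\lfloor\log_2 n\rfloor+1$, and this maximum is attained by every graph $Q_{n,1}$. In particular, quantum graphs of valence $1$ have unbounded chromatic number. -/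

import Mathlib

universe u

/-- A quantum graph: a finite dimensional complex inner product space `V` together with a real
vector space `E` of self-adjoint operators on `V` that contains the identity. -/
structure QuantumGraph where
  /-- The vertex space. -/
  V : Type u
  [normedAddCommGroup : NormedAddCommGroup V]
  [innerProductSpace : InnerProductSpace ℂ V]
  [finiteDimensional : FiniteDimensional ℂ V]
  /-- The edge space. -/
  E : Submodule ℝ (V →ₗ[ℂ] V)
  isSymmetric_of_mem : ∀ A ∈ E, A.IsSymmetric
  id_mem : LinearMap.id ∈ E

attribute [instance] QuantumGraph.normedAddCommGroup QuantumGraph.innerProductSpace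
  QuantumGraph.finiteDimensional

namespace QuantumGraph

/-- The order of `G`: the dimension of the vertex space. -/
noncomputable def order (G : QuantumGraph.{u}) : ℕ := Module.finrank ℂ G.V

/-- The valence of `G`: one less than the real dimension of the edge space. (The subtraction
truncates only on the zero vertex space.) -/
noncomputable def valence (G : QuantumGraph.{u}) : ℕ := Module.finrank ℝ G.E - 1

/-- The orthogonal projection onto `C`, as an operator on the vertex space. -/
noncomputable def proj (G : QuantumGraph.{u}) (C : Submodule ℂ G.V) : G.V →ₗ[ℂ] G.V :=
  (C.starProjection : G.V →ₗ[ℂ] G.V)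

/-- A code of `G`: a subspace `C` with `P A P = ε(A) P` for all `A` in the edge space and some
real-valued function `ε`, where `P` is the orthogonal projection onto `C`. -/
def IsCode (G : QuantumGraph.{u}) (C : Submodule ℂ G.V) : Prop :=
  ∃ ε : G.E → ℝ, ∀ A : G.E,
    G.proj C ∘ₗ (A : G.V →ₗ[ℂ] G.V) ∘ₗ G.proj C = ((ε A : ℝ) : ℂ) • G.proj C

/-- A coloring of `G`: a set of codes whose projections sum to the identity. -/
def IsColoring (G : QuantumGraph.{u}) (K : Finset (Submodule ℂ G.V)) : Prop :=
  (∀ C ∈ K, G.IsCode C) ∧ ∑ C ∈ K, G.proj C = LinearMap.id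

/-- The independence number: the dimension of the largest code. -/
noncomputable def independenceNumber (G : QuantumGraph.{u}) : ℕ :=
  sSup {d : ℕ | ∃ C : Submodule ℂ G.V, G.IsCode C ∧ Module.finrank ℂ C = d}

/-- The chromatic number: the cardinality of the smallest coloring. -/
noncomputable def chromaticNumber (G : QuantumGraph.{u}) : ℕ :=
  sInf {k : ℕ | ∃ K : Finset (Submodule ℂ G.V), G.IsColoring K ∧ K.card = k}

/-- The chromatic numbers of all quantum graphs of order `n` and valence `m`. -/
def chromaticNumbers (n m : ℕ) : Set ℕ :=
  {k | ∃ G : QuantumGraph.{u}, G.order = n ∧ G.valence = m ∧ G.chromaticNumber = k}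

/-- `G` is one of the graphs `Q_{n,m}`: it has order `n`, valence `m` and a commutative edge space
with a basis `I, A₀, …, A_{m-1}` that is tropical and cyclical. Here `lam i j` and `w i j` are
the `j`-th eigenvalue and the `j`-th (normalized) eigenvector of `A i`; all indices start at `0`. -/
def IsQ (G : QuantumGraph.{u}) (n m : ℕ) : Prop :=
  G.order = n ∧ G.valence = m ∧
  (∀ A ∈ G.E, ∀ B ∈ G.E, A ∘ₗ B = B ∘ₗ A) ∧
  ∃ (A : Fin m → (G.V →ₗ[ℂ] G.V)) (lam : Fin m → Fin n → ℝ)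
    (w : Fin m → OrthonormalBasis (Fin n) ℂ G.V),
    -- the identity and the `A i` form a basis of the edge space
    LinearIndependent ℝ (Fin.cons LinearMap.id A : Fin (m + 1) → (G.V →ₗ[ℂ] G.V)) ∧
    Submodule.span ℝ (Set.range (Fin.cons LinearMap.id A : Fin (m + 1) → (G.V →ₗ[ℂ] G.V))) = G.E ∧
    -- eigenvalues and eigenvectors
    (∀ i j, A i (w i j) = ((lam i j : ℝ) : ℂ) • w i j) ∧
    -- tropical
    (∀ (i : Fin m) (j j' : Fin n), (j' : ℕ) = j + 1 →
      0 < lam i j' ∧ lam i j' < lam i j / (n : ℝ) ^ 2) ∧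
    -- cyclical
    (∀ (i i' : Fin m) (j j' : Fin n), (i' : ℕ) = i + 1 →
      (j' : ℕ) = (j + n / m + if (i : ℕ) < n % m then 1 else 0) % n →
      w i' j = w i j')

end QuantumGraph

/-- The step logarithm: `slog 0 q = 0` and `slog p q = slog (p - ⌈p / q⌉) q + 1` for positive
`p` and `q`. (The value for `q = 0` is a dummy.) -/
noncomputable def slog (p q : ℕ) : ℕ :=
  if h : 0 < p ∧ 0 < q then slog (p - ⌈(p : ℚ) / q⌉₊) q + 1 else 0
termination_by p
decreasing_by
  have hp : (0 : ℚ) < p := by exact_mod_cast h.1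
  have hq : (0 : ℚ) < q := by exact_mod_cast h.2
  have hc : 0 < ⌈(p : ℚ) / q⌉₊ := Nat.ceil_pos.mpr (div_pos hp hq)
  omega

/-! Lower bounds on codes come from Tverberg's theorem. If `m` operators are diagonal in a common
orthonormal basis, their joint eigenvalues are `n` points of ℝ^m. When `r * (m + 1) < n`, `tverberg`
splits these points into `r + 1` weighted classes with a common barycentre. Taking square roots of
the weights as coordinates gives one unit vector per class, and these vectors span a code
(`exists_code_of_orthonormal`). A single symmetric operator can be compressed to any subspace and
diagonalized there, so in valence 1 every subspace contains a code of at least half its dimension.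
Splitting such codes off repeatedly colors the graph with `slog n 2` codes
(`exists_orthogonal_codes`).

The opposite bounds come from the tropical condition. Counting from 0, the value of a code of
dimension more than `k` is at most the `k`-th eigenvalue, so its unit vectors have squared
coordinates at most 1/n² at positions before `k`. The cyclical condition puts all but at most `r`
basis vectors among the first `r` eigenvectors of some operator, where `n ≤ r * (m + 1)`. A code of
dimension more than `r` contains a nonzero vector orthogonal to the exceptional ones, and all its
coordinates are too small (`finrank_code_le`). For colorings, some code outside a subfamily of total
dimension `s` has dimension at most `s + 1`, so `k` codes fill at most 2^k - 1 dimensions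
(`lt_two_pow_card_of_sum_starProjection`).

Existence uses cyclic shifts of one geometric progression as eigenvalues. -/

open scoped InnerProductSpace

/-! ### Colorful Carathéodory and Tverberg -/

/-- Bárány's argument: take the rainbow hull nearest to the origin, with nearest point `P`. If `P ≠
0`, then `P` is a positive combination of affinely independent vertices on the hyperplane ⟪P, ·⟫ =
‖P‖². This misses the origin, so they are linearly independent and some color is unused. Exchanging
its point for one with nonpositive product with `P` brings the hull closer. -/
theorem colorful_caratheodory {E J K : Type*} [NormedAddCommGroup E] [InnerProductSpace ℝ E]
    [FiniteDimensional ℝ E] [Fintype J] [Finite K] [Nonempty K] (y : J → K → E)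
    (hcard : Module.finrank ℝ E < Fintype.card J)
    (hy : ∀ j p, ∃ k, ⟪p, y j k⟫_ℝ ≤ 0) :
    ∃ f : J → K, (0 : E) ∈ convexHull ℝ (Set.range fun j => y j (f j)) := by
  classical
  have hJ : Nonempty J := Fintype.card_pos_iff.mp (by omega)
  have hmin : ∀ f : J → K, ∃ p ∈ convexHull ℝ (Set.range fun j => y j (f j)),
      ∀ q ∈ convexHull ℝ (Set.range fun j => y j (f j)), ‖p‖ ≤ ‖q‖ := by
    intro f
    have hc : IsCompact (convexHull ℝ (Set.range fun j => y j (f j))) :=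
      (Set.finite_range _).isCompact_convexHull (𝕜 := ℝ)
    obtain ⟨p, hp, h⟩ := hc.exists_isMinOn
      ((Set.range_nonempty _).convexHull) (continuous_norm.continuousOn)
    exact ⟨p, hp, fun q hq => h hq⟩
  choose p hp hpmin using hmin
  obtain ⟨f, hf⟩ := Finite.exists_min (fun f : J → K => ‖p f‖)
  refine ⟨f, ?_⟩
  by_cases h0 : p f = 0
  · exact h0 ▸ hp f
  exfalso
  set P := p f with hP
  have hsupp : ∀ q ∈ convexHull ℝ (Set.range fun j => y j (f j)), ‖P‖ ^ 2 ≤ ⟪P, q⟫_ℝ := by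
    intro q hq
    have hconv := convex_convexHull ℝ (Set.range fun j => y j (f j))
    have := (norm_eq_iInf_iff_real_inner_le_zero hconv (u := 0) (hp f)).mp (by
      have : Nonempty (convexHull ℝ (Set.range fun j => y j (f j))) := ⟨⟨_, hp f⟩⟩
      apply le_antisymm
      · exact le_ciInf fun w => by simpa using hpmin f w w.2
      · exact ciInf_le ⟨0, by rintro _ ⟨w, rfl⟩; positivity⟩
          (⟨_, hp f⟩ : convexHull ℝ (Set.range fun j => y j (f j)))) q hq
    rw [zero_sub, inner_neg_left, inner_sub_right, real_inner_self_eq_norm_sq] at this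
    linarith
  obtain ⟨ι, _, z, c, hz, hind, hcpos, hc1, hcz⟩ := eq_pos_convex_span_of_mem_convexHull (hp f)
  have hzP : ∀ i, ⟪P, z i⟫_ℝ = ‖P‖ ^ 2 := by
    have hsum : ∑ i, c i * (⟪P, z i⟫_ℝ - ‖P‖ ^ 2) = 0 := by
      simp_rw [mul_sub, Finset.sum_sub_distrib, ← Finset.sum_mul, hc1, ← real_inner_smul_right,
        ← inner_sum, hcz, ← hP, real_inner_self_eq_norm_sq]
      ring
    have hnn : ∀ i ∈ Finset.univ, 0 ≤ c i * (⟪P, z i⟫_ℝ - ‖P‖ ^ 2) := fun i _ =>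
      mul_nonneg (hcpos i).le
        (sub_nonneg.mpr (hsupp _ (subset_convexHull ℝ _ (hz ⟨i, rfl⟩))))
    intro i
    have := (Finset.sum_eq_zero_iff_of_nonneg hnn).mp hsum i (Finset.mem_univ i)
    rcases mul_eq_zero.mp this with h | h
    · exact absurd h (hcpos i).ne'
    · linarith
  have hPpos : 0 < ‖P‖ ^ 2 := by positivity
  have hlin : LinearIndependent ℝ z := by
    rw [Fintype.linearIndependent_iff]
    intro a ha
    have hs : ∑ i, a i = 0 := by
      have := congrArg (fun q => ⟪P, q⟫_ℝ) ha
      simp only [inner_sum, real_inner_smul_right, hzP, inner_zero_right, ← Finset.sum_mul] at this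
      exact (mul_eq_zero.mp this).resolve_right hPpos.ne'
    intro i
    exact (affineIndependent_iff.mp hind) Finset.univ a hs ha i (Finset.mem_univ i)
  have hι : Fintype.card ι < Fintype.card J := hlin.fintype_card_le_finrank.trans_lt hcard
  choose g hg using fun i => hz ⟨i, rfl⟩
  obtain ⟨j, hj⟩ : ∃ j, j ∉ Set.range g := by
    by_contra! h
    exact absurd (Fintype.card_le_of_surjective g h) (not_le.mpr hι)
  obtain ⟨k, hk⟩ := hy j P
  set f' := Function.update f j k with hf'
  have hmem : P ∈ convexHull ℝ (Set.range fun j => y j (f' j)) := by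
    rw [hP, ← hcz]
    refine (convex_convexHull ℝ _).sum_mem (fun i _ => (hcpos i).le) hc1 fun i _ =>
      subset_convexHull ℝ _ ⟨g i, ?_⟩
    have : g i ≠ j := fun h => hj ⟨i, h⟩
    simpa [hf', Function.update_of_ne this] using hg i
  have hmem' : y j k ∈ convexHull ℝ (Set.range fun j => y j (f' j)) :=
    subset_convexHull ℝ _ ⟨j, by simp [hf']⟩
  set Y := y j k
  have hYP : 0 < ‖Y - P‖ ^ 2 := by
    have : Y - P ≠ 0 := by
      intro h
      rw [sub_eq_zero.mp h, real_inner_self_eq_norm_sq] at hk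
      linarith
    positivity
  have hseg : ∀ t : ℝ, 0 ≤ t → t ≤ 1 → ‖P‖ ^ 2 ≤ ‖P + t • (Y - P)‖ ^ 2 := by
    intro t ht0 ht1
    have h1 : P + t • (Y - P) ∈ convexHull ℝ (Set.range fun j => y j (f' j)) :=
      (convex_convexHull ℝ _).add_smul_sub_mem hmem hmem' ⟨ht0, ht1⟩
    have := (hf f').trans (hpmin f' _ h1)
    gcongr
  have hexp : ∀ t : ℝ, ‖P + t • (Y - P)‖ ^ 2 =
      ‖P‖ ^ 2 + 2 * t * (⟪P, Y⟫_ℝ - ‖P‖ ^ 2) + t ^ 2 * ‖Y - P‖ ^ 2 := by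
    intro t
    rw [norm_add_sq_real, real_inner_smul_right, inner_sub_right, real_inner_self_eq_norm_sq,
      norm_smul, mul_pow, Real.norm_eq_abs, sq_abs]
    ring
  set N := ‖Y - P‖ ^ 2
  -- With this `t` the quadratic term `t ^ 2 * N` is at most `t * ‖P‖ ^ 2`, half of what the linear
  -- term gains.
  have ht : 0 < ‖P‖ ^ 2 / (N + ‖P‖ ^ 2) := by positivity
  have h := hseg _ ht.le (div_le_one_of_le₀ (by linarith) (by positivity))
  rw [hexp] at h
  set t := ‖P‖ ^ 2 / (N + ‖P‖ ^ 2)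
  have htN : t * N ≤ ‖P‖ ^ 2 := by
    have : t * (N + ‖P‖ ^ 2) = ‖P‖ ^ 2 := div_mul_cancel₀ _ (by positivity)
    nlinarith
  nlinarith

/-- Sarkaria's tensor trick: a rainbow zero among the vectors v_k ⊗ (1, x_j) in dimension `r * (m +
1)` forces all classes to have the same mass and the same moment. -/
theorem tverberg {m n r : ℕ} (x : Fin n → Fin m → ℝ) (hr : r * (m + 1) < n) :
    ∃ (f : Fin n → Fin (r + 1)) (c : Fin n → ℝ) (e : Fin m → ℝ), (∀ j, 0 ≤ c j) ∧
      (∀ k, ∑ j, (if f j = k then c j else 0) = 1) ∧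
      ∀ k i, ∑ j, (if f j = k then c j * x j i else 0) = e i := by
  classical
  -- The vectors e_1, …, e_r, -(e_1 + ⋯ + e_r): up to scaling, their only linear relation has equal
  -- coefficients.
  let v : Fin (r + 1) → Fin r → ℝ := fun k a => if k = a.castSucc then 1 else
    if k = Fin.last r then -1 else 0
  let X : Fin n → Fin (m + 1) → ℝ := fun j => Fin.cons 1 (x j)
  let y : Fin n → Fin (r + 1) → EuclideanSpace ℝ (Fin r × Fin (m + 1)) := fun j k =>
    WithLp.toLp 2 fun ab => v k ab.1 * X j ab.2
  have hv : ∀ a, ∑ k, v k a = 0 := by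
    intro a
    simp only [v]
    rw [Fin.sum_univ_castSucc]
    simp [Fin.castSucc_inj, Fin.castSucc_ne_last, (Fin.castSucc_ne_last a).symm]
  have hysum : ∀ j, ∑ k, y j k = 0 := by
    intro j
    ext ab
    simp [y, ← Finset.sum_mul, hv]
  obtain ⟨f, hf⟩ := colorful_caratheodory y (by simpa using hr) (by
    intro j p
    by_contra! h
    have h1 : 0 < ∑ k, ⟪p, y j k⟫_ℝ := Finset.sum_pos (fun k _ => h k) Finset.univ_nonempty
    rw [← inner_sum, hysum, inner_zero_right] at h1
    exact lt_irrefl _ h1)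
  rw [convexHull_range_eq_exists_affineCombination] at hf
  obtain ⟨s, w, hw0, hw1, h⟩ := hf
  rw [s.affineCombination_eq_linear_combination _ _ hw1] at h
  let c : Fin n → ℝ := fun j => if j ∈ s then w j else 0
  have hc0 : ∀ j, 0 ≤ c j := fun j => by
    by_cases hj : j ∈ s <;> simp [c, hj, hw0]
  have hc1 : ∑ j, c j = 1 := by simpa [c] using hw1
  have hcy : ∀ a b, ∑ j, c j * (v (f j) a * X j b) = 0 := by
    intro a b
    have := congrArg (fun q : EuclideanSpace ℝ (Fin r × Fin (m + 1)) => q (a, b)) h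
    simpa [c, y, Finset.sum_apply] using this
  let M : Fin (r + 1) → Fin (m + 1) → ℝ := fun k b => ∑ j, if f j = k then c j * X j b else 0
  have hM : ∀ k b, M k b = M (Fin.last r) b := by
    intro k b
    refine Fin.lastCases rfl (fun a => ?_) k
    rw [← sub_eq_zero, ← hcy a b, ← Finset.sum_sub_distrib]
    refine Finset.sum_congr rfl fun j _ => ?_
    simp only [v]
    by_cases h1 : f j = a.castSucc
    · simp [h1]
    · by_cases h2 : f j = Fin.last r
      · simp [h2, (Fin.castSucc_ne_last a).symm]
      · simp [h1, h2]
  have hM0 : (r + 1 : ℝ) * M (Fin.last r) 0 = 1 := by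
    have h1 : ∑ k, M k 0 = 1 := by
      simp only [M]
      rw [Finset.sum_comm, ← hc1]
      exact Finset.sum_congr rfl fun j _ => by simp [X]
    simpa [hM] using h1
  -- Each class has mass 1/(r + 1), hence the rescaling.
  refine ⟨f, fun j => (r + 1) * c j, fun i => (r + 1) * M (Fin.last r) i.succ,
    fun j => mul_nonneg (by positivity) (hc0 j), fun k => ?_, fun k i => ?_⟩
  · refine Eq.trans ?_ hM0
    rw [← hM k 0, Finset.mul_sum]
    exact Finset.sum_congr rfl fun j _ => by simp [X]
  · simp only [← hM k i.succ, M, Finset.mul_sum]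
    exact Finset.sum_congr rfl fun j _ => by simp [X, mul_assoc]

/-! ### Codes from orthonormal systems -/

section Operators

variable {V : Type*} [NormedAddCommGroup V] [InnerProductSpace ℂ V]

theorem inner_map_eq_of_mem_span {κ : Type*} (z : κ → V) (A : V →ₗ[ℂ] V) (e : ℂ)
    (h : ∀ k l, ⟪z k, A (z l)⟫_ℂ = e * ⟪z k, z l⟫_ℂ) :
    ∀ x ∈ Submodule.span ℂ (Set.range z), ∀ y ∈ Submodule.span ℂ (Set.range z),
      ⟪x, A y⟫_ℂ = e * ⟪x, y⟫_ℂ := by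
  intro x hx y hy
  induction hx using Submodule.span_induction with
  | zero => simp
  | add a b _ _ ha hb => rw [inner_add_left, inner_add_left, ha, hb, mul_add]
  | smul c a _ ha => rw [inner_smul_left, inner_smul_left, ha, mul_left_comm]
  | mem a ha =>
    obtain ⟨k, rfl⟩ := ha
    induction hy using Submodule.span_induction with
    | zero => simp
    | add a b _ _ ha hb => rw [map_add, inner_add_right, inner_add_right, ha, hb, mul_add]
    | smul c a _ ha => rw [map_smul, inner_smul_right, inner_smul_right, ha, mul_left_comm]
    | mem a ha =>
      obtain ⟨l, rfl⟩ := ha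
      exact h k l

/-- The vectors `z k` have disjoint supports, so the off-diagonal entries vanish; the diagonal ones
are the Tverberg barycentre. Only the compression of `A i` to the span of `u` must be diagonal,
which allows use inside a subspace. -/
theorem exists_code_of_orthonormal {m n r : ℕ} {u : Fin n → V} (hu : Orthonormal ℂ u)
    (A : Fin m → V →ₗ[ℂ] V) (lam : Fin m → Fin n → ℝ)
    (hA : ∀ i j k, ⟪u j, A i (u k)⟫_ℂ = if j = k then (lam i j : ℂ) else 0)
    (hr : r * (m + 1) < n) :
    ∃ C ≤ Submodule.span ℂ (Set.range u), Module.finrank ℂ C = r + 1 ∧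
      ∀ i, ∃ e : ℝ, ∀ x ∈ C, ∀ y ∈ C, ⟪x, A i y⟫_ℂ = e * ⟪x, y⟫_ℂ := by
  obtain ⟨f, c, e, hc0, hc1, hce⟩ := tverberg (fun j i => lam i j) hr
  let d : Fin (r + 1) → Fin n → ℝ := fun k j => if f j = k then √(c j) else 0
  let z : Fin (r + 1) → V := fun k => ∑ j, (d k j : ℂ) • u j
  have hd : ∀ k l j, d k j * d l j = if k = l then (if f j = k then c j else 0) else 0 := by
    intro k l j
    simp only [d]
    by_cases h : k = l
    · subst h
      by_cases h2 : f j = k <;> simp [h2, Real.mul_self_sqrt (hc0 j)]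
    · by_cases h2 : f j = k
      · simp [h, h2]
      · simp [h, h2]
  have hu' := orthonormal_iff_ite.mp hu
  have hzz : ∀ k l, ⟪z k, z l⟫_ℂ = if k = l then 1 else 0 := by
    intro k l
    have : ⟪z k, z l⟫_ℂ = ((∑ j, d k j * d l j : ℝ) : ℂ) := by
      simp [z, hu', mul_comm]
    rw [this]
    by_cases h : k = l
    · simp only [hd, if_pos h, hc1, Complex.ofReal_one]
    · simp [hd, h]
  have hzA : ∀ i k l, ⟪z k, A i (z l)⟫_ℂ = e i * ⟪z k, z l⟫_ℂ := by
    intro i k l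
    have : ⟪z k, A i (z l)⟫_ℂ = ((∑ j, d k j * d l j * lam i j : ℝ) : ℂ) := by
      simp [z, hA, mul_assoc, mul_left_comm]
    rw [this, hzz]
    by_cases h : k = l
    · simp only [hd, if_pos h, mul_one, ← hce k i, ite_mul, zero_mul]
    · simp [hd, h]
  have hz : Orthonormal ℂ z := orthonormal_iff_ite.mpr hzz
  refine ⟨Submodule.span ℂ (Set.range z), ?_, ?_, fun i => ⟨e i, ?_⟩⟩
  · rw [Submodule.span_le]
    rintro _ ⟨k, rfl⟩
    exact Submodule.sum_mem _ fun j _ =>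
      Submodule.smul_mem _ _ (Submodule.subset_span ⟨j, rfl⟩)
  · simpa using finrank_span_eq_card hz.linearIndependent
  · exact inner_map_eq_of_mem_span z (A i) (e i) (hzA i)

theorem exists_mem_orthogonal_of_finrank_lt [FiniteDimensional ℂ V] {U C : Submodule ℂ V}
    (h : Module.finrank ℂ U < Module.finrank ℂ C) : ∃ v ∈ C, v ∈ Uᗮ ∧ v ≠ 0 := by
  have h1 := U.finrank_add_finrank_orthogonal
  have h2 := Submodule.finrank_sup_add_finrank_inf_eq C Uᗮ
  have h3 := Submodule.finrank_le (C ⊔ Uᗮ)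
  have h4 : C ⊓ Uᗮ ≠ ⊥ := by
    intro h0
    rw [h0, finrank_bot] at h2
    omega
  obtain ⟨v, hv, hv0⟩ := Submodule.exists_mem_ne_zero_of_ne_bot h4
  exact ⟨v, hv.1, hv.2, hv0⟩

theorem finrank_span_image_le {ι : Type*} (g : ι → V) (s : Finset ι) :
    Module.finrank ℂ (Submodule.span ℂ (g '' s)) ≤ s.card := by
  classical
  rw [← Finset.coe_image]
  exact (finrank_span_finset_le_card _).trans Finset.card_image_le

theorem inner_eq_zero_of_mem_orthogonal_span_image {ι : Type*} {g : ι → V} {s : Finset ι} {v : V}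
    (hv : v ∈ (Submodule.span ℂ (g '' s))ᗮ) {i : ι} (hi : i ∈ s) : ⟪g i, v⟫_ℂ = 0 :=
  (Submodule.mem_orthogonal _ _).mp hv _ (Submodule.subset_span ⟨i, hi, rfl⟩)

/-- The quadratic form of an operator in an orthonormal basis of eigenvectors. -/
theorem inner_map_self_eq_sum {n : ℕ} (w : OrthonormalBasis (Fin n) ℂ V) (A : V →ₗ[ℂ] V)
    (lam : Fin n → ℝ) (hA : ∀ j, A (w j) = (lam j : ℂ) • w j) (v : V) :
    ⟪v, A v⟫_ℂ = ((∑ j, lam j * ‖⟪w j, v⟫_ℂ‖ ^ 2 : ℝ) : ℂ) := by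
  have h : A v = ∑ j, (lam j * ⟪w j, v⟫_ℂ) • w j := by
    conv_lhs => rw [← w.sum_repr' v]
    rw [map_sum]
    exact Finset.sum_congr rfl fun j _ => by rw [map_smul, hA, smul_smul, mul_comm]
  rw [h, inner_sum]
  push_cast
  refine Finset.sum_congr rfl fun j _ => ?_
  rw [inner_smul_right, mul_assoc, ← inner_conj_symm v (w j), Complex.mul_conj,
    Complex.normSq_eq_norm_sq]
  push_cast
  rfl

end Operators

/-! ### The step logarithm in base 2 -/

theorem slog_zero (q : ℕ) : slog 0 q = 0 := by
  rw [slog]; simp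

theorem slog_two {p : ℕ} (hp : 0 < p) : slog p 2 = slog (p / 2) 2 + 1 := by
  have h : ⌈(p : ℚ) / 2⌉₊ = p - p / 2 := by
    rw [Nat.ceil_eq_iff (by omega), lt_div_iff₀ two_pos, div_le_iff₀ two_pos]
    constructor
    · exact_mod_cast (by omega : (p - p / 2 - 1) * 2 < p)
    · exact_mod_cast (by omega : p ≤ (p - p / 2) * 2)
  rw [slog, dif_pos ⟨hp, two_pos⟩, Nat.cast_ofNat, h]
  congr 2
  omega

theorem slog_two_eq_log {n : ℕ} (hn : 0 < n) : slog n 2 = Nat.log 2 n + 1 := by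
  induction n using Nat.strong_induction_on with
  | _ n ih =>
    rw [slog_two hn]
    rcases Nat.lt_or_ge n 2 with h | h
    · have : n = 1 := by omega
      subst this
      simp [slog_zero]
    · rw [ih (n / 2) (by omega) (by omega), Nat.log_of_one_lt_of_le one_lt_two h]

/-! ### Splitting off codes of one operator -/

section Decomposition

variable {V : Type*} [NormedAddCommGroup V] [InnerProductSpace ℂ V] [FiniteDimensional ℂ V]

theorem starProjection_eq_add_of_le {C W : Submodule ℂ V} (h : C ≤ W) (v : V) :
    W.starProjection v = C.starProjection v + (Cᗮ ⊓ W).starProjection v := by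
  have h1 : (Cᗮ ⊓ W).starProjection v = W.starProjection v - C.starProjection v := by
    apply Submodule.eq_starProjection_of_mem_orthogonal
    · refine ⟨?_, W.sub_mem (W.starProjection_apply_mem v) (h (C.starProjection_apply_mem v))⟩
      have : W.starProjection v - C.starProjection v =
          (v - C.starProjection v) - (v - W.starProjection v) := by abel
      rw [this]
      exact Cᗮ.sub_mem (C.sub_starProjection_mem_orthogonal v)
        (Submodule.orthogonal_le h (W.sub_starProjection_mem_orthogonal v))
    · rw [Submodule.mem_orthogonal]
      rintro x ⟨hxC, hxW⟩
      have : v - (W.starProjection v - C.starProjection v) =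
          (v - W.starProjection v) + C.starProjection v := by abel
      rw [this, inner_add_right,
        (Submodule.mem_orthogonal _ _).mp (W.sub_starProjection_mem_orthogonal v) x hxW,
        (Submodule.mem_orthogonal' _ _).mp hxC _ (C.starProjection_apply_mem v), add_zero]
  rw [h1]
  abel

theorem exists_half_code (A : V →ₗ[ℂ] V) (hA : A.IsSymmetric) (W : Submodule ℂ V)
    (hW : 0 < Module.finrank ℂ W) :
    ∃ C ≤ W, Module.finrank ℂ C = Module.finrank ℂ W - Module.finrank ℂ W / 2 ∧
      ∃ e : ℝ, ∀ x ∈ C, ∀ y ∈ C, ⟪x, A y⟫_ℂ = e * ⟪x, y⟫_ℂ := by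
  set d := Module.finrank ℂ W with hd
  let B : W →ₗ[ℂ] W := (W.orthogonalProjectionOnto : V →ₗ[ℂ] W) ∘ₗ A ∘ₗ W.subtype
  have hBA : ∀ x y : W, ⟪x, B y⟫_ℂ = ⟪(x : V), A y⟫_ℂ := fun x y =>
    Submodule.inner_orthogonalProjectionOnto_eq_of_mem_left x (A y)
  have hB : B.IsSymmetric := by
    intro x y
    rw [← inner_conj_symm, hBA, hBA, ← hA, inner_conj_symm]
  let b := hB.eigenvectorBasis hd.symm
  let lam := hB.eigenvalues hd.symm
  have hu : Orthonormal ℂ fun j => (b j : V) := b.orthonormal.comp_linearIsometry W.subtypeₗᵢ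
  -- This is the largest `r` with `2 * r < d`, and then `r + 1 = d - d / 2`.
  obtain ⟨C, hC, hCd, hCe⟩ := exists_code_of_orthonormal (m := 1) (r := (d - 1) / 2) hu
    (fun _ => A) (fun _ => lam) (by
      intro _ j k
      rw [← hBA, hB.apply_eigenvectorBasis, inner_smul_right,
        orthonormal_iff_ite.mp b.orthonormal]
      by_cases h : j = k
      · simp [h, lam]
      · simp [h]) (by omega)
  refine ⟨C, hC.trans ?_, by omega, hCe 0⟩
  rw [Submodule.span_le]
  rintro _ ⟨j, rfl⟩
  exact (b j).2

/-- Remove a half-dimensional code and recurse on its orthogonal complement in `W`, of dimension `d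
/ 2`; the recursion is that of `slog d 2`. -/
theorem exists_orthogonal_codes (A : V →ₗ[ℂ] V) (hA : A.IsSymmetric) (d : ℕ) :
    ∀ W : Submodule ℂ V, Module.finrank ℂ W = d →
      ∃ K : Finset (Submodule ℂ V), K.card ≤ slog d 2 ∧
        (∀ C ∈ K, C ≤ W ∧ ∃ e : ℝ, ∀ x ∈ C, ∀ y ∈ C, ⟪x, A y⟫_ℂ = e * ⟪x, y⟫_ℂ) ∧
        ∀ v, ∑ C ∈ K, C.starProjection v = W.starProjection v := by
  classical
  induction d using Nat.strong_induction_on with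
  | _ d ih =>
    intro W hW
    rcases Nat.eq_zero_or_pos d with h0 | hd
    · refine ⟨∅, by simp, by simp, fun v => ?_⟩
      rw [h0, Submodule.finrank_eq_zero] at hW
      subst hW
      simp
    · obtain ⟨C, hCW, hC, hCe⟩ := exists_half_code A hA W (by omega)
      have hW' := Submodule.finrank_add_inf_finrank_orthogonal hCW
      obtain ⟨K, hK, hKe, hsum⟩ := ih (d / 2) (by omega) (Cᗮ ⊓ W) (by omega)
      -- Otherwise `C ≤ Cᗮ`, so `C` would be zero.
      have hCK : C ∉ K := by
        intro h
        have h1 : C ≤ C ⊓ Cᗮ := le_inf le_rfl ((hKe C h).1.trans inf_le_left)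
        rw [Submodule.inf_orthogonal_eq_bot, le_bot_iff] at h1
        rw [h1, finrank_bot] at hC
        omega
      refine ⟨insert C K, ?_, ?_, fun v => ?_⟩
      · rw [Finset.card_insert_of_notMem hCK, slog_two hd]
        omega
      · intro D hD
        rcases Finset.mem_insert.mp hD with rfl | hD
        · exact ⟨hCW, hCe⟩
        · exact ⟨(hKe D hD).1.trans inf_le_right, (hKe D hD).2⟩
      · rw [Finset.sum_insert hCK, hsum, ← starProjection_eq_add_of_le hCW]

end Decomposition

/-! ### Codes as scalar forms; colorings in valence 1 -/

namespace QuantumGraph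

theorem isCode_iff (G : QuantumGraph.{u}) (C : Submodule ℂ G.V) :
    G.IsCode C ↔ ∀ A ∈ G.E, ∃ e : ℝ, ∀ x ∈ C, ∀ y ∈ C, ⟪x, A y⟫_ℂ = e * ⟪x, y⟫_ℂ := by
  constructor
  · rintro ⟨ε, h⟩ A hA
    refine ⟨ε ⟨A, hA⟩, fun x hx y hy => ?_⟩
    have h1 := congrArg (fun q => ⟪x, q⟫_ℂ) (LinearMap.congr_fun (h ⟨A, hA⟩) y)
    have hx' := Submodule.starProjection_eq_self_iff.mpr hx
    have hy' := Submodule.starProjection_eq_self_iff.mpr hy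
    simpa [proj, hy', ← Submodule.inner_starProjection_left_eq_right, hx', inner_smul_right]
      using h1
  · intro h
    choose ε hε using fun A : G.E => h A A.2
    refine ⟨ε, fun A => LinearMap.ext fun v => ext_inner_left ℂ fun x => ?_⟩
    have h1 := hε A _ (C.starProjection_apply_mem x) _ (C.starProjection_apply_mem v)
    rw [Submodule.inner_starProjection_left_eq_right,
      Submodule.inner_starProjection_left_eq_right,
      Submodule.starProjection_eq_self_iff.mpr (C.starProjection_apply_mem v)] at h1
    simpa [proj, inner_smul_right, -Complex.coe_smul] using h1

theorem isCode_of_span_eq {G : QuantumGraph.{u}} {m : ℕ} {A : Fin m → G.V →ₗ[ℂ] G.V}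
    (hA : Submodule.span ℝ
      (Set.range (Fin.cons LinearMap.id A : Fin (m + 1) → (G.V →ₗ[ℂ] G.V))) = G.E)
    {C : Submodule ℂ G.V}
    (h : ∀ i, ∃ e : ℝ, ∀ x ∈ C, ∀ y ∈ C, ⟪x, A i y⟫_ℂ = e * ⟪x, y⟫_ℂ) : G.IsCode C := by
  rw [isCode_iff]
  intro B hB
  rw [← hA] at hB
  induction hB using Submodule.span_induction with
  | zero => exact ⟨0, by simp⟩
  | add a b _ _ ha hb =>
    obtain ⟨e, he⟩ := ha
    obtain ⟨f, hf⟩ := hb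
    refine ⟨e + f, fun x hx y hy => ?_⟩
    rw [LinearMap.add_apply, inner_add_right, he x hx y hy, hf x hx y hy]
    push_cast
    ring
  | smul c a _ ha =>
    obtain ⟨e, he⟩ := ha
    refine ⟨c * e, fun x hx y hy => ?_⟩
    rw [LinearMap.smul_apply, ← Complex.coe_smul, inner_smul_right, he x hx y hy]
    push_cast
    ring
  | mem a ha =>
    obtain ⟨i, rfl⟩ := ha
    refine Fin.cases ?_ (fun i => ?_) i
    · exact ⟨1, by simp⟩
    · simpa using h i

theorem exists_coloring_card_le_slog {n : ℕ} (hn : 2 ≤ n) {G : QuantumGraph.{u}}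
    (h1 : G.order = n) (h2 : G.valence = 1) : 
    ∃ K : Finset (Submodule ℂ G.V), G.IsColoring K ∧ K.card ≤ slog n 2 := by
  have hdim : Module.finrank ℝ G.E = 2 := by
    unfold valence at h2
    omega
  have hid : (LinearMap.id : G.V →ₗ[ℂ] G.V) ≠ 0 := by
    have : Nontrivial G.V :=
      Module.nontrivial_of_finrank_pos (R := ℂ) (by unfold order at h1; omega)
    intro h
    obtain ⟨x, hx⟩ := exists_ne (0 : G.V)
    exact hx (LinearMap.congr_fun h x)
  obtain ⟨A, hA, hAid⟩ : ∃ A ∈ G.E, A ∉ Submodule.span ℝ {(LinearMap.id : G.V →ₗ[ℂ] G.V)} := by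
    by_contra! h
    have h3 := Submodule.finrank_mono (show G.E ≤ _ from h)
    rw [finrank_span_singleton hid] at h3
    omega
  have hli : LinearIndependent ℝ
      (Fin.cons LinearMap.id (fun _ => A) : Fin (1 + 1) → (G.V →ₗ[ℂ] G.V)) := by
    have h3 := (LinearIndependent.pair_iff' (K := ℝ) hid (y := A)).mpr fun a ha =>
      hAid (Submodule.mem_span_singleton.mpr ⟨a, ha⟩)
    have h4 : (Fin.cons LinearMap.id (fun _ => A) : Fin (1 + 1) → (G.V →ₗ[ℂ] G.V)) =
        ![LinearMap.id, A] := by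
      ext i
      fin_cases i <;> rfl
    rw [h4]
    exact h3
  have hspan : Submodule.span ℝ (Set.range
      (Fin.cons LinearMap.id (fun _ => A) : Fin (1 + 1) → (G.V →ₗ[ℂ] G.V))) = G.E := by
    have hfin : FiniteDimensional ℝ G.E := Module.finite_of_finrank_pos (by omega)
    refine Submodule.eq_of_le_of_finrank_eq ?_ ?_
    · rw [Submodule.span_le]
      rintro _ ⟨i, rfl⟩
      refine Fin.cases ?_ (fun i => ?_) i
      · exact G.id_mem
      · exact hA
    · rw [finrank_span_eq_card hli, hdim]
      simp
  obtain ⟨K, hK, hKe, hsum⟩ := exists_orthogonal_codes A (G.isSymmetric_of_mem A hA) n ⊤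
    (by rw [finrank_top]; exact h1)
  refine ⟨K, ⟨fun C hC => isCode_of_span_eq hspan fun _ => (hKe C hC).2, ?_⟩, hK⟩
  ext v
  simpa [proj, LinearMap.sum_apply, Submodule.starProjection_top] using hsum v

theorem chromaticNumber_le_slog {n : ℕ} (hn : 2 ≤ n) {G : QuantumGraph.{u}} (h1 : G.order = n)
    (h2 : G.valence = 1) : G.chromaticNumber ≤ slog n 2 := by
  obtain ⟨K, hK, hcard⟩ := exists_coloring_card_le_slog hn h1 h2
  refine le_trans (Nat.sInf_le ?_) hcard
  exact ⟨K, hK, rfl⟩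

end QuantumGraph

/-! ### Tropical sequences -/

/-- A sequence is tropical if each term is positive and smaller than its predecessor by a factor
of more than `n ^ 2`. -/
def IsTropical {n : ℕ} (lam : Fin n → ℝ) : Prop :=
  ∀ j j' : Fin n, (j' : ℕ) = j + 1 → 0 < lam j' ∧ lam j' < lam j / (n : ℝ) ^ 2

namespace IsTropical

variable {n : ℕ} {lam : Fin n → ℝ}

theorem pos (h : IsTropical lam) (hn : 2 ≤ n) (j : Fin n) : 0 < lam j := by
  have hn' : (0 : ℝ) < (n : ℝ) ^ 2 := by positivity
  by_cases hj : (j : ℕ) + 1 < n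
  · have h1 := h j ⟨j + 1, hj⟩ rfl
    have h2 := h1.1.trans h1.2
    exact (div_pos_iff_of_pos_right hn').mp h2
  · exact (h ⟨j - 1, by omega⟩ j (by simp; omega)).1

theorem lt_div (h : IsTropical lam) (hn : 2 ≤ n) {j j' : Fin n} (hj : j < j') :
    lam j' < lam j / (n : ℝ) ^ 2 := by
  obtain ⟨k, hk⟩ := j'
  induction k with
  | zero => exact absurd (Fin.lt_def.mp hj) (by simp)
  | succ k ih =>
    have h1 := (h ⟨k, by omega⟩ ⟨k + 1, hk⟩ rfl).2
    rcases Nat.lt_or_ge j k with h2 | h2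
    · have h3 := ih (by omega) h2
      have h4 : lam ⟨k, by omega⟩ / (n : ℝ) ^ 2 ≤ lam ⟨k, by omega⟩ :=
        div_le_self (h.pos hn _).le (one_le_pow₀ (by exact_mod_cast (by omega : 1 ≤ n)))
      linarith
    · have h5 : j = ⟨k, by omega⟩ := Fin.ext (by have := Fin.lt_def.mp hj; simp at this ⊢; omega)
      rw [h5]
      exact h1

theorem le (h : IsTropical lam) (hn : 2 ≤ n) {j j' : Fin n} (hj : j ≤ j') : lam j' ≤ lam j := by
  rcases hj.eq_or_lt with rfl | hj
  · exact le_rfl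
  · exact (h.lt_div hn hj).le.trans
      (div_le_self (h.pos hn _).le (one_le_pow₀ (by exact_mod_cast (by omega : 1 ≤ n))))

end IsTropical

/-! ### Tropical bounds on codes and colorings -/

section Eigenbasis

variable {V : Type*} [NormedAddCommGroup V] [InnerProductSpace ℂ V] [FiniteDimensional ℂ V]
  {n : ℕ} {w : OrthonormalBasis (Fin n) ℂ V} {lam : Fin n → ℝ} {A : V →ₗ[ℂ] V}
  {C : Submodule ℂ V} {e : ℝ}

omit [FiniteDimensional ℂ V] in
theorem code_value_mul_sq_norm (hA : ∀ j, A (w j) = (lam j : ℂ) • w j)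
    (hC : ∀ x ∈ C, ∀ y ∈ C, ⟪x, A y⟫_ℂ = e * ⟪x, y⟫_ℂ) {v : V} (hv : v ∈ C) :
    ∑ j, lam j * ‖⟪w j, v⟫_ℂ‖ ^ 2 = e * ‖v‖ ^ 2 := by
  have h := hC v hv v hv
  rw [inner_map_self_eq_sum w A lam hA, inner_self_eq_norm_sq_to_K] at h
  apply Complex.ofReal_injective
  rw [h]
  push_cast
  rfl

/-- The value of a code of dimension more than `j` is at most the `j`-th eigenvalue. -/
theorem code_value_le (hn : 2 ≤ n) (hlam : IsTropical lam)
    (hA : ∀ j, A (w j) = (lam j : ℂ) • w j)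
    (hC : ∀ x ∈ C, ∀ y ∈ C, ⟪x, A y⟫_ℂ = e * ⟪x, y⟫_ℂ) {j : Fin n}
    (hj : (j : ℕ) < Module.finrank ℂ C) : e ≤ lam j := by
  -- Only `j` conditions are imposed, so some nonzero `v` in `C` sees no eigenvalue above `lam j`.
  have h1 : Module.finrank ℂ (Submodule.span ℂ (w '' (Finset.Iio j : Finset (Fin n)))) <
      Module.finrank ℂ C := by
    refine (finrank_span_image_le w _).trans_lt ?_
    simpa using hj
  obtain ⟨v, hvC, hv, hv0⟩ := exists_mem_orthogonal_of_finrank_lt h1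
  have h2 := code_value_mul_sq_norm hA hC hvC
  have h3 : ∑ k, lam k * ‖⟪w k, v⟫_ℂ‖ ^ 2 ≤ ∑ k, lam j * ‖⟪w k, v⟫_ℂ‖ ^ 2 := by
    refine Finset.sum_le_sum fun k _ => ?_
    by_cases hk : k < j
    · simp [inner_eq_zero_of_mem_orthogonal_span_image hv (Finset.mem_Iio.mpr hk)]
    · exact mul_le_mul_of_nonneg_right (hlam.le hn (not_lt.mp hk)) (by positivity)
  rw [h2, ← Finset.mul_sum, w.sum_sq_norm_inner_right] at h3
  exact le_of_mul_le_mul_right h3 (by positivity)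

/-- Vectors of a code of dimension more than `k` have small coordinates at positions
less than `k`. -/
theorem sq_norm_inner_le_of_mem_code (hn : 2 ≤ n) (hlam : IsTropical lam)
    (hA : ∀ j, A (w j) = (lam j : ℂ) • w j)
    (hC : ∀ x ∈ C, ∀ y ∈ C, ⟪x, A y⟫_ℂ = e * ⟪x, y⟫_ℂ) {j k : Fin n} (hjk : j < k)
    (hk : (k : ℕ) < Module.finrank ℂ C) {v : V} (hv : v ∈ C) :
    ‖⟪w j, v⟫_ℂ‖ ^ 2 ≤ ‖v‖ ^ 2 / (n : ℝ) ^ 2 := by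
  have h1 := code_value_mul_sq_norm hA hC hv
  have h2 : lam j * ‖⟪w j, v⟫_ℂ‖ ^ 2 ≤ e * ‖v‖ ^ 2 := by
    rw [← h1]
    exact Finset.single_le_sum (f := fun j => lam j * ‖⟪w j, v⟫_ℂ‖ ^ 2)
      (fun i _ => mul_nonneg (hlam.pos hn i).le (by positivity)) (Finset.mem_univ j)
  have h3 := (code_value_le hn hlam hA hC hk).trans (hlam.lt_div hn hjk).le
  have h4 : lam j * ‖⟪w j, v⟫_ℂ‖ ^ 2 ≤ lam j * (‖v‖ ^ 2 / (n : ℝ) ^ 2) := by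
    refine h2.trans ((mul_le_mul_of_nonneg_right h3 (by positivity)).trans_eq (by ring))
  exact le_of_mul_le_mul_left h4 (hlam.pos hn j)

theorem finrank_sup_id_le_sum (T : Finset (Submodule ℂ V)) :
    Module.finrank ℂ (T.sup id : Submodule ℂ V) ≤ ∑ D ∈ T, Module.finrank ℂ D := by
  classical
  induction T using Finset.induction_on with
  | empty => simp
  | insert D T hD ih =>
    rw [Finset.sup_insert, Finset.sum_insert hD]
    exact (Submodule.finrank_add_le_finrank_add_finrank _ _).trans (by simpa using ih)

theorem sum_sq_norm_starProjection {K : Finset (Submodule ℂ V)} {v : V}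
    (hsum : ∑ C ∈ K, C.starProjection v = v) : ∑ C ∈ K, ‖C.starProjection v‖ ^ 2 = ‖v‖ ^ 2 := by
  have h : ∀ C : Submodule ℂ V,
      ⟪v, C.starProjection v⟫_ℂ = ((‖C.starProjection v‖ ^ 2 : ℝ) : ℂ) := by
    intro C
    have h1 := inner_self_eq_norm_sq_to_K (𝕜 := ℂ) (C.starProjection v)
    rw [Submodule.inner_starProjection_left_eq_right,
      Submodule.starProjection_eq_self_iff.mpr (C.starProjection_apply_mem v)] at h1
    rw [h1]
    push_cast
    rfl
  have h2 := congrArg (fun q => ⟪v, q⟫_ℂ) hsum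
  simp only [inner_sum, h, inner_self_eq_norm_sq_to_K] at h2
  apply Complex.ofReal_injective
  rw [Complex.ofReal_sum, h2]
  push_cast
  rfl

omit [FiniteDimensional ℂ V] in
/-- The quadratic form of a positive operator on a sum of vectors from several codes. -/
theorem quadratic_form_sum_le (hlam : ∀ j, 0 ≤ lam j)
    (hA : ∀ j, A (w j) = (lam j : ℂ) • w j) {S : Finset (Submodule ℂ V)} {ε : Submodule ℂ V → ℝ}
    (hS : ∀ C ∈ S, ∀ x ∈ C, ∀ y ∈ C, ⟪x, A y⟫_ℂ = ε C * ⟪x, y⟫_ℂ)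
    (hε : ∀ C ∈ S, ε C ≤ e) {x : Submodule ℂ V → V} (hx : ∀ C ∈ S, x C ∈ C) :
    ∑ j, lam j * ‖⟪w j, ∑ C ∈ S, x C⟫_ℂ‖ ^ 2 ≤ S.card * (e * ∑ C ∈ S, ‖x C‖ ^ 2) := by
  calc ∑ j, lam j * ‖⟪w j, ∑ C ∈ S, x C⟫_ℂ‖ ^ 2
      ≤ ∑ j, lam j * (S.card * ∑ C ∈ S, ‖⟪w j, x C⟫_ℂ‖ ^ 2) := by
        refine Finset.sum_le_sum fun j _ => mul_le_mul_of_nonneg_left ?_ (hlam j)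
        rw [inner_sum]
        refine le_trans ?_ sq_sum_le_card_mul_sum_sq
        gcongr
        exact norm_sum_le _ _
    _ = S.card * ∑ C ∈ S, ∑ j, lam j * ‖⟪w j, x C⟫_ℂ‖ ^ 2 := by
        rw [Finset.sum_comm, Finset.mul_sum]
        refine Finset.sum_congr rfl fun j _ => ?_
        rw [← Finset.mul_sum]
        ring
    _ ≤ S.card * (e * ∑ C ∈ S, ‖x C‖ ^ 2) := by
        refine mul_le_mul_of_nonneg_left ?_ (by positivity)
        rw [Finset.mul_sum]
        refine Finset.sum_le_sum fun C hC => ?_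
        rw [code_value_mul_sq_norm hA (hS C hC) (hx C hC)]
        exact mul_le_mul_of_nonneg_right (hε C hC) (by positivity)

/-- Given codes whose projections sum to the identity, some code outside of a set `T` of them has
dimension at most one more than the total dimension of `T`. -/
theorem exists_finrank_le_of_sum_starProjection [DecidableEq (Submodule ℂ V)] (hn : 2 ≤ n)
    (hlam : IsTropical lam)
    (hA : ∀ j, A (w j) = (lam j : ℂ) • w j) {K : Finset (Submodule ℂ V)}
    (hsum : ∀ v, ∑ C ∈ K, C.starProjection v = v)
    {ε : Submodule ℂ V → ℝ}
    (hK : ∀ C ∈ K, ∀ x ∈ C, ∀ y ∈ C, ⟪x, A y⟫_ℂ = ε C * ⟪x, y⟫_ℂ)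
    (hcard : K.card ≤ n) {T : Finset (Submodule ℂ V)} (hT : T ⊆ K) (hne : (K \ T).Nonempty) :
    ∃ C ∈ K \ T, Module.finrank ℂ C ≤ ∑ D ∈ T, Module.finrank ℂ D + 1 := by
  -- Maximality lets the value of `C` bound those of all codes outside `T`.
  obtain ⟨C, hC, hmax⟩ := Finset.exists_max_image (K \ T) ε hne
  refine ⟨C, hC, ?_⟩
  have hCK := (Finset.mem_sdiff.mp hC).1
  have hfr : Module.finrank ℂ V = n := by simpa using Module.finrank_eq_card_basis w.toBasis
  have hCn : Module.finrank ℂ C ≤ n := hfr ▸ C.finrank_le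
  set s := ∑ D ∈ T, Module.finrank ℂ D with hs
  by_contra! hlt
  have hsn : s + 1 < n := by omega
  let a : Fin n := ⟨s, by omega⟩
  let b : Fin n := ⟨s + 1, hsn⟩
  have hεb : ε C ≤ lam b := code_value_le hn hlam hA (hK C hCK) hlt
  have hab := hlam.lt_div hn (show a < b from Nat.lt_succ_self s)
  -- At most s + (n - 1 - s) = n - 1 conditions: some nonzero `v` is orthogonal to `T` and to the
  -- eigenvectors after `a`, so its form is at least `lam a * ‖v‖ ^ 2`.
  have h1 : Module.finrank ℂ (T.sup id ⊔ Submodule.span ℂ (w '' (Finset.Ioi a : Finset (Fin n))) :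
      Submodule ℂ V) < Module.finrank ℂ (⊤ : Submodule ℂ V) := by
    have h2 : Module.finrank ℂ (T.sup id : Submodule ℂ V) ≤ s := finrank_sup_id_le_sum T
    have h3 := finrank_span_image_le w (Finset.Ioi a)
    have h4 : (Finset.Ioi a).card = n - 1 - s := by simp [a]
    have h5 := Submodule.finrank_add_le_finrank_add_finrank (T.sup id)
      (Submodule.span ℂ (w '' (Finset.Ioi a : Finset (Fin n))))
    rw [finrank_top, hfr]
    omega
  obtain ⟨v, -, hv, hv0⟩ := exists_mem_orthogonal_of_finrank_lt h1
  rw [← Submodule.inf_orthogonal] at hv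
  have hvT : ∀ D ∈ T, D.starProjection v = 0 := by
    intro D hD
    rw [Submodule.starProjection_apply_eq_zero_iff]
    exact Submodule.orthogonal_le (Finset.le_sup (f := id) hD) hv.1
  have hvsum : ∑ D ∈ K \ T, D.starProjection v = v := by
    have h2 := hsum v
    rwa [← Finset.sum_sdiff hT, Finset.sum_eq_zero hvT, add_zero] at h2
  have h2 : lam a * ‖v‖ ^ 2 ≤ ∑ j, lam j * ‖⟪w j, v⟫_ℂ‖ ^ 2 := by
    rw [← w.sum_sq_norm_inner_right, Finset.mul_sum]
    refine Finset.sum_le_sum fun k _ => ?_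
    by_cases hk : a < k
    · simp [inner_eq_zero_of_mem_orthogonal_span_image hv.2 (Finset.mem_Ioi.mpr hk)]
    · exact mul_le_mul_of_nonneg_right (hlam.le hn (not_lt.mp hk)) (by positivity)
  have h3 := quadratic_form_sum_le (fun j => (hlam.pos hn j).le) hA
    (fun D hD => hK D (Finset.mem_sdiff.mp hD).1) hmax
    (fun D _ => D.starProjection_apply_mem v)
  rw [hvsum, sum_sq_norm_starProjection hvsum, ← mul_assoc] at h3
  have h4 : lam a ≤ (K \ T).card * ε C :=
    le_of_mul_le_mul_right (h2.trans h3) (by positivity)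
  have h5 : ((K \ T).card : ℝ) ≤ n :=
    mod_cast (Finset.card_le_card Finset.sdiff_subset).trans hcard
  have h6 := hlam.pos hn a
  have h7 := hlam.pos hn b
  have hn' : (1 : ℝ) ≤ n := by exact_mod_cast (by omega : 1 ≤ n)
  have h9 : 0 ≤ ε C := by
    by_contra! h
    have := mul_nonpos_of_nonneg_of_nonpos (Nat.cast_nonneg (α := ℝ) (K \ T).card) h.le
    linarith
  have h8 : ((K \ T).card : ℝ) * ε C ≤ n * lam b := by gcongr
  rw [lt_div_iff₀ (by positivity)] at hab
  -- The contradiction is between `lam a ≤ n * lam b` and `lam b * n ^ 2 < lam a`.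
  nlinarith [mul_le_mul_of_nonneg_left hn' (by positivity : 0 ≤ lam b * n)]

/-- Codes are picked greedily: a total of at most 2^i - 1 grows to at most 2(2^i - 1) + 1 = 2^(i+1)
- 1. Once all are picked, they span the space. -/
theorem lt_two_pow_card_of_sum_starProjection (hn : 2 ≤ n) (hlam : IsTropical lam)
    (hA : ∀ j, A (w j) = (lam j : ℂ) • w j) {K : Finset (Submodule ℂ V)}
    (hsum : ∀ v, ∑ C ∈ K, C.starProjection v = v)
    (hK : ∀ C ∈ K, ∃ e : ℝ, ∀ x ∈ C, ∀ y ∈ C, ⟪x, A y⟫_ℂ = e * ⟪x, y⟫_ℂ) :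
    n < 2 ^ K.card := by
  classical
  -- Zero codes are allowed, so `K.card` may exceed `n`; that case is trivial.
  have hcard : K.card ≤ n ∨ n < K.card := le_or_gt _ _
  rcases hcard with hcard | hcard
  swap
  · exact hcard.trans Nat.lt_two_pow_self
  choose! ε hε using hK
  have key : ∀ i ≤ K.card, ∃ T ⊆ K, T.card = i ∧ ∑ D ∈ T, Module.finrank ℂ D + 1 ≤ 2 ^ i := by
    intro i
    induction i with
    | zero => exact fun _ => ⟨∅, by simp⟩
    | succ i ih =>
      intro hi
      obtain ⟨T, hT, hTi, hTs⟩ := ih (by omega)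
      obtain ⟨C, hC, hCT⟩ := exists_finrank_le_of_sum_starProjection hn hlam hA hsum hε hcard hT
        (by rw [← Finset.card_pos, Finset.card_sdiff_of_subset hT]; omega)
      obtain ⟨hCK, hCn⟩ := Finset.mem_sdiff.mp hC
      refine ⟨insert C T, Finset.insert_subset hCK hT, ?_, ?_⟩
      · rw [Finset.card_insert_of_notMem hCn, hTi]
      · rw [Finset.sum_insert hCn, pow_succ]
        omega
  obtain ⟨T, hT, hTc, hTs⟩ := key _ le_rfl
  obtain rfl := Finset.eq_of_subset_of_card_le hT hTc.ge
  have htop : T.sup id = (⊤ : Submodule ℂ V) := by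
    refine eq_top_iff.mpr fun v _ => ?_
    rw [← hsum v]
    exact Submodule.sum_mem _ fun C hC =>
      (Finset.le_sup (f := id) hC : C ≤ _) (C.starProjection_apply_mem v)
  have h1 := finrank_sup_id_le_sum T
  have hfr : Module.finrank ℂ V = n := by simpa using Module.finrank_eq_card_basis w.toBasis
  rw [htop, finrank_top, hfr] at h1
  omega

end Eigenbasis

/-! ### Blocks of indices and the cyclical condition -/

/-- The first index of the `i`-th block, where `n` indices are cut into `m` blocks whose lengths
differ by at most one, the longer blocks coming first. -/
def blockStart (n m i : ℕ) : ℕ := i * (n / m) + min i (n % m)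

theorem blockStart_zero (n m : ℕ) : blockStart n m 0 = 0 := by simp [blockStart]

theorem blockStart_succ (n m i : ℕ) :
    blockStart n m (i + 1) = blockStart n m i + n / m + if i < n % m then 1 else 0 := by
  unfold blockStart
  rw [add_mul, one_mul]
  split_ifs <;> omega

theorem blockStart_self {m : ℕ} (n : ℕ) (hm : 0 < m) : blockStart n m m = n := by
  unfold blockStart
  rw [min_eq_right (Nat.mod_lt n hm).le, Nat.div_add_mod]

theorem exists_mem_block {n m k p : ℕ} (hp : p < blockStart n m k) :
    ∃ i < k, blockStart n m i ≤ p ∧ p < blockStart n m (i + 1) := by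
  induction k with
  | zero => simp [blockStart_zero] at hp
  | succ k ih =>
    by_cases h : p < blockStart n m k
    · obtain ⟨i, hi, h⟩ := ih h
      exact ⟨i, hi.trans k.lt_succ_self, h⟩
    · exact ⟨k, k.lt_succ_self, not_lt.mp h, hp⟩

/-- If `n ≤ r * (m + 1)`, then at most `r` indices are not among the first `r` of a block. -/
theorem card_filter_block_le {n m r : ℕ} (hm : 0 < m) (hr : n ≤ r * (m + 1)) :
    (Finset.univ.filter fun p : Fin n =>
      ∀ i < m, ∀ j < r, (p : ℕ) ≠ blockStart n m i + j).card ≤ r := by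
  have h1 : ((Finset.univ.filter fun p : Fin n =>
      ∀ i < m, ∀ j < r, (p : ℕ) ≠ blockStart n m i + j).map Fin.valEmbedding) ⊆
      (Finset.range m).biUnion fun i =>
        Finset.Ico (blockStart n m i + r) (blockStart n m (i + 1)) := by
    intro p hp
    simp only [Finset.mem_map, Finset.mem_filter, Finset.mem_univ, true_and] at hp
    obtain ⟨p, hp, rfl⟩ := hp
    obtain ⟨i, hi, h2, h3⟩ := exists_mem_block (k := m) (p := p)
      (by rw [blockStart_self n hm]; exact p.2)
    rw [Finset.mem_biUnion]
    refine ⟨i, Finset.mem_range.mpr hi, Finset.mem_Ico.mpr ⟨?_, h3⟩⟩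
    by_contra! h4
    change (p : ℕ) < _ at h4
    exact hp i hi (p - blockStart n m i) (by omega) (by omega)
  have h2 := (Finset.card_le_card h1).trans Finset.card_biUnion_le
  rw [Finset.card_map] at h2
  refine h2.trans ?_
  simp only [Nat.card_Ico]
  -- If `n / m < r`, every block has length at most `r` and nothing is left over; otherwise exactly
  -- `n - m * r` indices are.
  rcases Nat.lt_or_ge (n / m) r with h | h
  · rw [Finset.sum_eq_zero]
    · exact Nat.zero_le r
    · intro i _
      rw [blockStart_succ]
      split_ifs <;> omega
  · have h3 : ∀ k, ∑ i ∈ Finset.range k, (blockStart n m (i + 1) - (blockStart n m i + r)) + k * r =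
        blockStart n m k := by
      intro k
      induction k with
      | zero => simp [blockStart_zero]
      | succ k ih =>
        rw [Finset.sum_range_succ, blockStart_succ, ← ih, add_mul]
        omega
    have h4 := h3 m
    rw [blockStart_self n hm] at h4
    have : r * (m + 1) = m * r + r := by ring
    omega

/-- The successive shifts add up to the block start, so all the bases are cyclic reorderings of the
first. -/
theorem cyclical_eq {α : Type*} {n m : ℕ} {w : Fin m → Fin n → α}
    (h : ∀ (i i' : Fin m) (j j' : Fin n), (i' : ℕ) = i + 1 →
      (j' : ℕ) = (j + n / m + if (i : ℕ) < n % m then 1 else 0) % n → w i' j = w i j')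
    (hm : 0 < m) (i : Fin m) (j p : Fin n) (hp : (p : ℕ) = (j + blockStart n m i) % n) :
    w i j = w ⟨0, hm⟩ p := by
  obtain ⟨i, hi⟩ := i
  induction i generalizing j with
  | zero =>
    have : p = j := Fin.ext (by rw [hp]; simp [blockStart_zero, Nat.mod_eq_of_lt])
    rw [this]
  | succ i ih =>
    have hn : 0 < n := j.pos
    rw [h ⟨i, by omega⟩ ⟨i + 1, hi⟩ j ⟨_, Nat.mod_lt _ hn⟩ rfl rfl]
    refine ih _ _ ?_
    rw [hp, blockStart_succ, Nat.mod_add_mod]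
    congr 1
    simp only
    ring

theorem ceil_div_succ {n : ℕ} (m : ℕ) (hn : 0 < n) :
    ⌈(n : ℚ) / ((m : ℚ) + 1)⌉₊ = (n - 1) / (m + 1) + 1 := by
  have h1 := Nat.div_add_mod (n - 1) (m + 1)
  have h2 := Nat.mod_lt (n - 1) (Nat.add_pos_right m one_pos)
  rw [mul_comm] at h1
  rw [Nat.ceil_eq_iff (Nat.succ_ne_zero _), lt_div_iff₀ (by positivity),
    div_le_iff₀ (by positivity)]
  constructor
  · rw [Nat.succ_sub_one]
    have h3 : (n - 1) / (m + 1) * (m + 1) < n := by omega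
    exact_mod_cast h3
  · have : ((n - 1) / (m + 1) + 1) * (m + 1) = (n - 1) / (m + 1) * (m + 1) + (m + 1) := by ring
    exact_mod_cast (by omega : n ≤ ((n - 1) / (m + 1) + 1) * (m + 1))

/-! ### Dimensions of codes under the cyclical condition -/

section Eigenbasis

variable {V : Type*} [NormedAddCommGroup V] [InnerProductSpace ℂ V] [FiniteDimensional ℂ V]

/-- If `C` were larger, some nonzero `v` in it would have all `n` squared coordinates at most
‖v‖²/n², giving ‖v‖² ≤ ‖v‖²/n with `n ≥ 2`. -/
theorem finrank_code_le {n m r : ℕ} (hr0 : 0 < r) (hr : n ≤ r * (m + 1))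
    {w : Fin m → OrthonormalBasis (Fin n) ℂ V} {lam : Fin m → Fin n → ℝ} {A : Fin m → V →ₗ[ℂ] V}
    (hV : Module.finrank ℂ V = n)
    (hlam : ∀ i, IsTropical (lam i)) (hA : ∀ i j, A i (w i j) = (lam i j : ℂ) • w i j)
    (hw : ∀ (i i' : Fin m) (j j' : Fin n), (i' : ℕ) = i + 1 →
      (j' : ℕ) = (j + n / m + if (i : ℕ) < n % m then 1 else 0) % n → w i' j = w i j')
    {C : Submodule ℂ V}
    (hC : ∀ i, ∃ e : ℝ, ∀ x ∈ C, ∀ y ∈ C, ⟪x, A i y⟫_ℂ = e * ⟪x, y⟫_ℂ) :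
    Module.finrank ℂ C ≤ r := by
  have hCn : Module.finrank ℂ C ≤ n := hV ▸ C.finrank_le
  rcases Nat.eq_zero_or_pos m with rfl | hm
  · omega
  by_contra! hlt
  have hn : 2 ≤ n := by omega
  obtain ⟨v, hvC, hv, hv0⟩ := exists_mem_orthogonal_of_finrank_lt
    (((finrank_span_image_le (w ⟨0, hm⟩) _).trans (card_filter_block_le hm hr)).trans_lt hlt)
  have h1 : ∀ p, ‖⟪w ⟨0, hm⟩ p, v⟫_ℂ‖ ^ 2 ≤ ‖v‖ ^ 2 / (n : ℝ) ^ 2 := by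
    intro p
    by_cases hp : ∀ i < m, ∀ j < r, (p : ℕ) ≠ blockStart n m i + j
    · rw [inner_eq_zero_of_mem_orthogonal_span_image hv (by simpa using hp)]
      rw [norm_zero, zero_pow two_ne_zero]
      positivity
    · push Not at hp
      obtain ⟨i, hi, j, hj, hp⟩ := hp
      have hwp := cyclical_eq (w := fun i j => w i j) hw hm ⟨i, hi⟩ ⟨j, by omega⟩ p
        (by rw [Nat.mod_eq_of_lt (by have := p.2; simp only; omega), hp, add_comm])
      rw [← hwp]
      obtain ⟨e, he⟩ := hC ⟨i, hi⟩
      exact sq_norm_inner_le_of_mem_code hn (hlam _) (hA _) he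
        (k := ⟨r, by omega⟩) (Fin.mk_lt_mk.mpr hj) hlt hvC
  have h2 := Finset.sum_le_sum fun p (_ : p ∈ Finset.univ) => h1 p
  rw [(w ⟨0, hm⟩).sum_sq_norm_inner_right, Finset.sum_const, Finset.card_univ, Fintype.card_fin,
    nsmul_eq_mul, ← mul_div_assoc, le_div_iff₀ (by positivity)] at h2
  have hv2 : 0 < ‖v‖ ^ 2 := by positivity
  have hn' : (2 : ℝ) ≤ n := by exact_mod_cast hn
  nlinarith [mul_pos hv2 (by linarith : (0 : ℝ) < n)]

theorem exists_code_of_cyclical {n m r : ℕ} (hr : r * (m + 1) < n)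
    {w : Fin m → OrthonormalBasis (Fin n) ℂ V} {lam : Fin m → Fin n → ℝ} {A : Fin m → V →ₗ[ℂ] V}
    (hV : Module.finrank ℂ V = n)
    (hA : ∀ i j, A i (w i j) = (lam i j : ℂ) • w i j)
    (hw : ∀ (i i' : Fin m) (j j' : Fin n), (i' : ℕ) = i + 1 →
      (j' : ℕ) = (j + n / m + if (i : ℕ) < n % m then 1 else 0) % n → w i' j = w i j') :
    ∃ C : Submodule ℂ V, Module.finrank ℂ C = r + 1 ∧
      ∀ i, ∃ e : ℝ, ∀ x ∈ C, ∀ y ∈ C, ⟪x, A i y⟫_ℂ = e * ⟪x, y⟫_ℂ := by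
  obtain ⟨u, hu⟩ : ∃ u : OrthonormalBasis (Fin n) ℂ V, ∀ i, ∃ mu : Fin n → ℝ,
      ∀ p, A i (u p) = (mu p : ℂ) • u p := by
    rcases Nat.eq_zero_or_pos m with rfl | hm
    · exact ⟨(stdOrthonormalBasis ℂ V).reindex (finCongr hV), fun i => i.elim0⟩
    · refine ⟨w ⟨0, hm⟩, fun i => ?_⟩
      have : ∀ p, ∃ mu : ℝ, A i (w ⟨0, hm⟩ p) = (mu : ℂ) • w ⟨0, hm⟩ p := by
        intro p
        have hn : 0 < n := p.pos
        have hs := Nat.mod_lt (blockStart n m i) hn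
        have hwp := cyclical_eq (w := fun i j => w i j) hw hm i
          -- This is `p - blockStart n m i` modulo `n`.
          ⟨(p + (n - blockStart n m i % n)) % n, Nat.mod_lt _ hn⟩ p (by
            rw [Nat.mod_add_mod, ← Nat.add_mod_mod, add_assoc, Nat.sub_add_cancel hs.le,
              Nat.add_mod_right, Nat.mod_eq_of_lt p.2])
        rw [← hwp]
        exact ⟨_, hA _ _⟩
      exact ⟨fun p => (this p).choose, fun p => (this p).choose_spec⟩
  choose mu hmu using hu
  obtain ⟨C, -, hC⟩ := exists_code_of_orthonormal u.orthonormal A mu (by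
    intro i j k
    rw [hmu, inner_smul_right, orthonormal_iff_ite.mp u.orthonormal]
    by_cases h : j = k
    · simp [h]
    · simp [h]) hr
  exact ⟨C, hC⟩

end Eigenbasis

/-! ### Invariants of the graphs `Q_{n,m}` -/

namespace QuantumGraph

theorem IsQ.pos {G : QuantumGraph.{u}} {n m : ℕ} (h : G.IsQ n m) : 0 < n := by
  obtain ⟨hord, -, -, A, lam, w, hli, -⟩ := h
  have h0 : (LinearMap.id : G.V →ₗ[ℂ] G.V) ≠ 0 := hli.ne_zero 0
  by_contra hn
  have hV : Module.finrank ℂ G.V = 0 := by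
    unfold order at hord
    omega
  have := Module.finrank_zero_iff.mp hV
  exact h0 (Subsingleton.elim _ _)

theorem IsQ.independenceNumber_eq {G : QuantumGraph.{u}} {n m : ℕ} (h : G.IsQ n m) :
    G.independenceNumber = ⌈(n : ℚ) / ((m : ℚ) + 1)⌉₊ := by
  have hn := h.pos
  rw [ceil_div_succ m hn]
  obtain ⟨hord, -, -, A, lam, w, -, hspan, hA, hlam, hw⟩ := h
  have h1 := Nat.div_add_mod (n - 1) (m + 1)
  have h2 := Nat.mod_lt (n - 1) (Nat.add_pos_right m one_pos)
  rw [mul_comm] at h1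
  set r := (n - 1) / (m + 1)
  have hub : ∀ d ∈ {d : ℕ | ∃ C : Submodule ℂ G.V, G.IsCode C ∧ Module.finrank ℂ C = d},
      d ≤ r + 1 := by
    rintro _ ⟨C, hC, rfl⟩
    rw [isCode_iff] at hC
    refine finrank_code_le (r := r + 1) r.succ_pos ?_ hord hlam hA hw fun i => hC _ ?_
    · have : (r + 1) * (m + 1) = r * (m + 1) + (m + 1) := by ring
      omega
    · rw [← hspan]
      exact Submodule.subset_span ⟨i.succ, by simp⟩
  obtain ⟨C, hC, hCe⟩ := exists_code_of_cyclical (r := r) (by omega) hord hA hw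
  have hmem : r + 1 ∈ {d : ℕ | ∃ C : Submodule ℂ G.V, G.IsCode C ∧ Module.finrank ℂ C = d} :=
    ⟨C, isCode_of_span_eq hspan hCe, hC⟩
  exact le_antisymm (csSup_le ⟨_, hmem⟩ hub) (le_csSup ⟨_, hub⟩ hmem)

theorem IsQ.two_le {G : QuantumGraph.{u}} {n : ℕ} (h : G.IsQ n 1) : 2 ≤ n := by
  have hn := h.pos
  obtain ⟨hord, -, -, A, lam, w, hli, -, hA, -⟩ := h
  by_contra hlt
  obtain rfl : n = 1 := by omega
  have h1 : A 0 = lam 0 0 • LinearMap.id := by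
    refine (w 0).toBasis.ext fun j => ?_
    rw [Subsingleton.elim j 0]
    simp [hA]
  have := (Fintype.linearIndependent_iff.mp hli) ![lam 0 0, -1] (by simp [Fin.sum_univ_two, h1]) 1
  simp at this

theorem IsQ.chromaticNumber_eq {G : QuantumGraph.{u}} {n : ℕ} (h : G.IsQ n 1) :
    G.chromaticNumber = slog n 2 := by
  have hn := h.two_le
  refine le_antisymm (chromaticNumber_le_slog hn h.1 h.2.1) ?_
  obtain ⟨hord, hval, -, A, lam, w, -, hspan, hA, hlam, -⟩ := h
  -- Without some coloring, `sInf` would take the default value 0.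
  have hne : {k : ℕ | ∃ K : Finset (Submodule ℂ G.V), G.IsColoring K ∧ K.card = k}.Nonempty :=
    let ⟨K, hK, _⟩ := exists_coloring_card_le_slog hn hord hval
    ⟨_, K, hK, rfl⟩
  obtain ⟨K, ⟨hK, hsum⟩, hKc⟩ := Nat.sInf_mem hne
  have h1 : n < 2 ^ K.card := by
    refine lt_two_pow_card_of_sum_starProjection hn (hlam 0) (hA 0) (fun v => ?_) fun C hC => ?_
    · simpa [proj, LinearMap.sum_apply] using LinearMap.congr_fun hsum v
    · refine (isCode_iff G C).mp (hK C hC) _ ?_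
      rw [← hspan]
      exact Submodule.subset_span ⟨Fin.succ 0, by simp⟩
  rw [slog_two_eq_log (by omega)]
  have h2 := Nat.log_lt_of_lt_pow (by omega) h1
  rw [hKc] at h2
  exact h2

end QuantumGraph

/-! ### Existence of the graphs `Q_{n,m}` -/

/-- The operator with given real eigenvalues in an orthonormal basis. -/
noncomputable def diagonalOperator {V ι : Type*} [NormedAddCommGroup V] [InnerProductSpace ℂ V]
    [Fintype ι] (b : OrthonormalBasis ι ℂ V) : (ι → ℝ) →ₗ[ℝ] (V →ₗ[ℂ] V) where
  toFun d := b.toBasis.constr ℂ fun p => (d p : ℂ) • b p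
  map_add' d d' := b.toBasis.ext fun p => by
    rw [LinearMap.add_apply]
    simp only [Module.Basis.constr_basis, Pi.add_apply, Complex.ofReal_add, add_smul]
  map_smul' c d := b.toBasis.ext fun p => by
    rw [LinearMap.smul_apply]
    simp only [Module.Basis.constr_basis, Pi.smul_apply, smul_eq_mul, Complex.ofReal_mul, mul_smul,
      RingHom.id_apply, Complex.coe_smul]

section

variable {V ι : Type*} [NormedAddCommGroup V] [InnerProductSpace ℂ V] [Fintype ι]
  (b : OrthonormalBasis ι ℂ V)

theorem diagonalOperator_apply_basis (d : ι → ℝ) (p : ι) :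
    diagonalOperator b d (b p) = (d p : ℂ) • b p := by
  have h := b.toBasis.constr_basis ℂ (fun p => (d p : ℂ) • b p) p
  rw [b.coe_toBasis] at h
  exact h

theorem diagonalOperator_injective : Function.Injective (diagonalOperator b) := by
  intro d d' h
  ext p
  have h1 := LinearMap.congr_fun h (b p)
  rw [diagonalOperator_apply_basis, diagonalOperator_apply_basis] at h1
  have h2 := smul_left_injective ℂ (b.orthonormal.ne_zero p) h1
  exact_mod_cast h2

theorem diagonalOperator_one : diagonalOperator b 1 = LinearMap.id :=
  b.toBasis.ext fun p => by simp [diagonalOperator_apply_basis]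

theorem isSymmetric_diagonalOperator (d : ι → ℝ) : (diagonalOperator b d).IsSymmetric := by
  classical
  have h : ∀ p q, ⟪diagonalOperator b d (b p), b q⟫_ℂ = ⟪b p, diagonalOperator b d (b q)⟫_ℂ := by
    intro p q
    rw [diagonalOperator_apply_basis, diagonalOperator_apply_basis, inner_smul_left,
      inner_smul_right, orthonormal_iff_ite.mp b.orthonormal]
    by_cases hpq : p = q
    · simp [hpq]
    · simp [hpq]
  intro x y
  rw [← b.sum_repr' x, ← b.sum_repr' y]
  simp only [map_sum, map_smul, sum_inner, inner_sum, inner_smul_left, inner_smul_right, h]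

theorem diagonalOperator_comm (d d' : ι → ℝ) :
    diagonalOperator b d ∘ₗ diagonalOperator b d' =
      diagonalOperator b d' ∘ₗ diagonalOperator b d :=
  b.toBasis.ext fun p => by
    simp only [b.coe_toBasis, LinearMap.comp_apply, diagonalOperator_apply_basis, map_smul,
      smul_smul, mul_comm]

end

theorem blockStart_lt_succ {n m : ℕ} (i : ℕ) (hm : 0 < m) (hmn : m ≤ n) :
    blockStart n m i < blockStart n m (i + 1) := by
  have := Nat.div_pos hmn hm
  rw [blockStart_succ]
  omega

/-- Cyclic shifts of a geometric progression are linearly independent together with the constant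
vector, if they have distinct starting points that leave some index free. -/
theorem linearIndependent_cons_one_geometric {n m : ℕ} [NeZero n] (hmn : m < n) {s : Fin m → Fin n}
    (hs : Function.Injective s) {t : ℝ} (ht0 : 0 < t) (ht1 : t < 1) :
    LinearIndependent ℝ
      (Fin.cons 1 fun i p => t ^ ((p - s i : Fin n) : ℕ) : Fin (m + 1) → Fin n → ℝ) := by
  rw [Fintype.linearIndependent_iff]
  intro g hg
  have hF : ∀ p, g 0 + ∑ i, g i.succ * t ^ ((p - s i : Fin n) : ℕ) = 0 := by
    intro p
    simpa [Fin.sum_univ_succ] using congrFun hg p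
  -- One minus `t` times the cyclic shift kills a geometric progression except where it wraps
  -- around. Applied to the relation, it turns the progressions into multiples of unit vectors and
  -- the constant 1 into `1 - t`.
  have hstep : ∀ q : Fin n, t ^ ((q : Fin n) : ℕ) - t * t ^ ((q - 1 : Fin n) : ℕ) =
      if q = 0 then 1 - t ^ n else 0 := by
    intro q
    obtain ⟨k, rfl⟩ : ∃ k, n = k + 1 := ⟨n - 1, by have := NeZero.pos n; omega⟩
    rw [← pow_succ']
    split_ifs with hq
    · subst hq
      simp [Fin.coe_neg_one]
    · have hq0 : 0 < (q : ℕ) := Nat.pos_of_ne_zero fun h => hq (Fin.ext (by simpa using h))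
      rw [Fin.val_sub_one_of_ne_zero hq, Nat.sub_add_cancel hq0, sub_self]
  have hG : ∀ p, g 0 * (1 - t) + ∑ i, g i.succ * (if p = s i then 1 - t ^ n else 0) = 0 := by
    intro p
    have h1 := hF p
    have h2 := hF (p - 1)
    have h3 : ∀ i, g i.succ * (if p = s i then 1 - t ^ n else 0) =
        g i.succ * t ^ ((p - s i : Fin n) : ℕ) -
          t * (g i.succ * t ^ ((p - 1 - s i : Fin n) : ℕ)) := by
      intro i
      have h4 := hstep (p - s i)
      rw [sub_right_comm p 1]
      simp only [sub_eq_zero] at h4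
      rw [← h4]
      ring
    simp only [h3, Finset.sum_sub_distrib, ← Finset.mul_sum]
    linear_combination h1 - t * h2
  have hg0 : g 0 = 0 := by
    obtain ⟨p, hp⟩ : ∃ p, p ∉ Set.range s := by
      by_contra! h
      have := Fintype.card_le_of_surjective s h
      simp at this
      omega
    have h1 := hG p
    rw [Finset.sum_eq_zero fun i _ => by rw [if_neg fun h => hp ⟨i, h.symm⟩, mul_zero],
      add_zero] at h1
    exact (mul_eq_zero.mp h1).resolve_right (by linarith)
  refine Fin.cases hg0 fun i => ?_
  have h1 := hG (s i)
  simp only [hg0, zero_mul, zero_add, hs.eq_iff, mul_ite, mul_zero, Finset.sum_ite_eq,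
    Finset.mem_univ, if_true] at h1
  refine (mul_eq_zero.mp h1).resolve_right ?_
  have := pow_lt_one₀ ht0.le ht1 (NeZero.ne n)
  linarith

theorem isTropical_geometric {n : ℕ} {t : ℝ} (ht : 0 < t) (htn : t < 1 / (n : ℝ) ^ 2) :
    IsTropical fun j : Fin n => t ^ (j : ℕ) := by
  intro j j' h
  refine ⟨by positivity, ?_⟩
  change t ^ (j' : ℕ) < t ^ (j : ℕ) / (n : ℝ) ^ 2
  rw [h, pow_succ, div_eq_mul_one_div]
  gcongr

namespace QuantumGraph

theorem exists_isQ {n m : ℕ} (hmn : m < n) : ∃ G : QuantumGraph.{u}, G.IsQ n m := by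
  have : NeZero n := ⟨by omega⟩
  let b : OrthonormalBasis (Fin n) ℂ (EuclideanSpace ℂ (ULift.{u} (Fin n))) :=
    (EuclideanSpace.basisFun _ ℂ).reindex Equiv.ulift
  have hn : (1 : ℝ) ≤ n := by exact_mod_cast (by omega : 1 ≤ n)
  let t : ℝ := 1 / ((n : ℝ) ^ 2 + 1)
  have ht0 : 0 < t := by positivity
  have htn : t < 1 / (n : ℝ) ^ 2 := one_div_lt_one_div_of_lt (by positivity) (by linarith)
  have ht1 : t < 1 := htn.trans_le (div_le_one_of_le₀ (one_le_pow₀ hn) (by positivity))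
  let s : Fin m → Fin n := fun i => Fin.ofNat n (blockStart n m i)
  have hsmono : ∀ i j, i < j → j ≤ m → blockStart n m i < blockStart n m j := by
    intro i j hij
    induction j, hij using Nat.le_induction with
    | base => exact fun h => blockStart_lt_succ i (by omega) hmn.le
    | succ j _ ih => exact fun h => (ih (by omega)).trans (blockStart_lt_succ j (by omega) hmn.le)
  have hsval : ∀ i, (s i : ℕ) = blockStart n m i := by
    intro i
    refine Nat.mod_eq_of_lt ?_
    have := hsmono i m i.2 le_rfl
    rwa [blockStart_self n i.pos] at this
  have hs : Function.Injective s := by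
    intro i j hij
    have h1 : blockStart n m i = blockStart n m j := by rw [← hsval, ← hsval, hij]
    rcases lt_trichotomy (i : ℕ) j with h | h | h
    · have := hsmono _ _ h j.2.le
      omega
    · exact Fin.ext h
    · have := hsmono _ _ h i.2.le
      omega
  let f : Fin m → Fin n → ℝ := fun i p => t ^ ((p - s i : Fin n) : ℕ)
  let g : Fin (m + 1) → Fin n → ℝ := Fin.cons 1 f
  have hg : LinearIndependent ℝ g := linearIndependent_cons_one_geometric hmn hs ht0 ht1
  let D := diagonalOperator b
  have hDg : D ∘ g = Fin.cons LinearMap.id fun i => D (f i) := by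
    funext k
    refine Fin.cases ?_ (fun i => ?_) k
    · exact diagonalOperator_one b
    · rfl
  have hDli : LinearIndependent ℝ (D ∘ g) :=
    hg.map' D (LinearMap.ker_eq_bot.mpr (diagonalOperator_injective b))
  have hmem : ∀ A ∈ Submodule.span ℝ (Set.range (D ∘ g)), ∃ d, A = D d := by
    intro A hA
    rw [Set.range_comp, Submodule.span_image] at hA
    obtain ⟨d, -, rfl⟩ := hA
    exact ⟨d, rfl⟩
  let G : QuantumGraph.{u} :=
    { V := EuclideanSpace ℂ (ULift.{u} (Fin n))
      E := Submodule.span ℝ (Set.range (D ∘ g))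
      isSymmetric_of_mem := by
        intro A hA
        obtain ⟨d, rfl⟩ := hmem A hA
        exact isSymmetric_diagonalOperator b d
      id_mem := Submodule.subset_span ⟨0, diagonalOperator_one b⟩ }
  -- The `j`-th eigenvector of the `i`-th operator is `b (j + s i)`, with eigenvalue `t ^ j`.
  refine ⟨G, ?_, ?_, ?_, fun i => D (f i), fun _ j => t ^ (j : ℕ),
    fun i => b.reindex (Equiv.addRight (s i)).symm, ?_, ?_, ?_, ?_, ?_⟩
  · exact (Module.finrank_eq_card_basis b.toBasis).trans (Fintype.card_fin n)
  · have h1 : Module.finrank ℝ G.E = m + 1 :=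
      (finrank_span_eq_card hDli).trans (Fintype.card_fin _)
    unfold valence
    omega
  · intro A hA B hB
    obtain ⟨d, rfl⟩ := hmem A hA
    obtain ⟨d', rfl⟩ := hmem B hB
    exact diagonalOperator_comm b d d'
  · exact hDg ▸ hDli
  · rw [← hDg]
  · intro i j
    rw [OrthonormalBasis.reindex_apply, Equiv.symm_symm, Equiv.coe_addRight]
    have h1 := diagonalOperator_apply_basis b (f i) (j + s i)
    simp only [f, add_sub_cancel_right] at h1
    exact h1
  · exact fun _ => isTropical_geometric ht0 htn
  · intro i i' j j' hi hj
    simp only [OrthonormalBasis.reindex_apply, Equiv.symm_symm, Equiv.coe_addRight]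
    congr 1
    apply Fin.ext
    rw [Fin.val_add, Fin.val_add, hj, hsval, hsval, hi, blockStart_succ, Nat.mod_add_mod]
    congr 1
    ring

end QuantumGraph

theorem corollary1 :
    -- the graphs `Q_{n,m}` exist for all `0 ≤ m < n`, and each has independence number `⌈n/(m+1)⌉`
    (∀ n m : ℕ, m < n → ∃ G : QuantumGraph.{u}, G.IsQ n m) ∧
    (∀ (n m : ℕ) (G : QuantumGraph.{u}), G.IsQ n m →
      G.independenceNumber = ⌈(n : ℚ) / ((m : ℚ) + 1)⌉₊) ∧
    -- the maximal chromatic number among graphs of order `n` and valence `1`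
    (∀ n : ℕ, 2 ≤ n →
      IsGreatest (QuantumGraph.chromaticNumbers.{u} n 1) (slog n 2) ∧
      slog n 2 = ⌊Real.logb 2 (n : ℝ)⌋₊ + 1) ∧
    -- the maximum is attained by the graphs `Q_{n,1}`
    (∀ (n : ℕ) (G : QuantumGraph.{u}), G.IsQ n 1 → G.chromaticNumber = slog n 2) ∧
    -- the chromatic number is unbounded on graphs of valence `1`
    (∀ k : ℕ, ∃ G : QuantumGraph.{u}, G.valence = 1 ∧ k < G.chromaticNumber) := by
  refine ⟨fun n m h => QuantumGraph.exists_isQ h, fun n m G h => h.independenceNumber_eq,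
    fun n hn => ⟨⟨?_, ?_⟩, ?_⟩, fun n G h => h.chromaticNumber_eq, fun k => ?_⟩
  · obtain ⟨G, hG⟩ := QuantumGraph.exists_isQ.{u} (n := n) (m := 1) hn
    exact ⟨G, hG.1, hG.2.1, hG.chromaticNumber_eq⟩
  · rintro _ ⟨G, h1, h2, rfl⟩
    exact QuantumGraph.chromaticNumber_le_slog hn h1 h2
  · have h := Real.natFloor_logb_natCast 2 n
    rw [Nat.cast_ofNat] at h
    rw [h, slog_two_eq_log (by omega)]
  -- Order 2^(k+1) gives chromatic number `k + 2`.
  · have h1 : 1 < 2 ^ (k + 1) := Nat.one_lt_two_pow k.succ_ne_zero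
    obtain ⟨G, hG⟩ := QuantumGraph.exists_isQ.{u} h1
    refine ⟨G, hG.2.1, ?_⟩
    rw [hG.chromaticNumber_eq, slog_two_eq_log (by omega), Nat.log_pow one_lt_two]
    omega
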